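/- All graphs are finite, simple and undirected, and $P_n$ denotes the path on $n$ vertices. For a graph $G$, let $HL(G)$ be the graph whose vertices are the edges of $G$, where two distinct edges of $G$ are adjacent in $HL(G)$ if and only if they share an endpoint and both lie in a common (not necessarily induced) subgraph of $G$ isomorphic to $P_n$. Let $HL^0(G)=G$ and $HL^{i+1}(G)=HL(HL^i(G))$. The sequence $\{HL^i(G)\}$ diverges by order if for every positive integer $N$ there is an integer $i\ge 0$ with $|V(HL^i(G))|\ge N$. Let $CL(x,y,z)$ be the graph of order $x+y+z+1$ consisting of three vertex-disjoint paths of orders $x$, $y$ and $z$ and one further vertex that is joined to one end vertex of each of the three paths. Theorem. Let $n$ and $k$ be natural numbers with $k+1<n\le 2k$. Then the sequence $\{HL^i(CL(k,k,n-k-1))\}$ diverges by order. -/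

import Mathlib

universe u v

/-- The `H`-line graph of `G`: its vertices are the edges of `G`, and two of them are adjacent when
they are distinct edges of `G` sharing an endpoint (that is, adjacent in the line graph of `G`)
and both lie in a common subgraph of `G` (not necessarily induced) isomorphic to `H`. -/
def HLineGraph {W : Type v} {V : Type u} (H : SimpleGraph W) (G : SimpleGraph V) :
    SimpleGraph G.edgeSet where
  Adj e f := G.lineGraph.Adj e f ∧
    ∃ S : G.Subgraph, Nonempty (H ≃g S.coe) ∧ (e : Sym2 V) ∈ S.edgeSet ∧ (f : Sym2 V) ∈ S.edgeSet
  symm := ⟨fun _ _ h => ⟨h.1.symm, h.2.imp fun _ hS => ⟨hS.1, hS.2.2, hS.2.1⟩⟩⟩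
  loopless := ⟨fun _ h => h.1.ne rfl⟩

/-- The iterated `H`-line graphs of `G`, each given with its vertex type:
the `0`-th is `G`, and the `(i + 1)`-st is the `H`-line graph of the `i`-th. -/
def HLineIter {W : Type v} {V : Type u} (H : SimpleGraph W) (G : SimpleGraph V) :
    ℕ → (X : Type u) × SimpleGraph X
  | 0 => ⟨V, G⟩
  | i + 1 => ⟨(HLineIter H G i).2.edgeSet, HLineGraph H (HLineIter H G i).2⟩

/-- For a finite graph `G`, the sequence of iterated `H`-line graphs of `G` diverges by order:
for every positive integer `N` some iterate has at least `N` vertices. -/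
def DivergesByOrder {W : Type v} {V : Type u} [Finite V] (H : SimpleGraph W)
    (G : SimpleGraph V) : Prop :=
  ∀ N : ℕ, 0 < N → ∃ i : ℕ, N ≤ Nat.card (HLineIter H G i).1

/-- Half of the adjacency of the spider, with edges oriented away from the center `none`:
the center is joined to the first vertex of each of the three legs,
and consecutive vertices of a leg are joined. -/
def spiderRel (x y z : ℕ) :
    Option (Fin x ⊕ Fin y ⊕ Fin z) → Option (Fin x ⊕ Fin y ⊕ Fin z) → Prop
  | none, some (.inl i) => i.val = 0
  | none, some (.inr (.inl i)) => i.val = 0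
  | none, some (.inr (.inr i)) => i.val = 0
  | some (.inl i), some (.inl j) => i.val + 1 = j.val
  | some (.inr (.inl i)), some (.inr (.inl j)) => i.val + 1 = j.val
  | some (.inr (.inr i)), some (.inr (.inr j)) => i.val + 1 = j.val
  | _, _ => False

/-- The spider `CL(x, y, z)`, of order `x + y + z + 1`: three vertex-disjoint paths of orders
`x`, `y` and `z`, together with a further vertex joined to one end vertex of each path. -/
def spiderCL (x y z : ℕ) : SimpleGraph (Option (Fin x ⊕ Fin y ⊕ Fin z)) :=
  SimpleGraph.fromRel (spiderRel x y z)

/-! Put m = n - k - 1, so 1 ≤ m < k. It suffices to follow a growing, not necessarily induced,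
subgraph through the iterates: two edges meeting at a vertex become adjacent as soon as they are
consecutive on some path with at least n vertices (`OnPath.hLineGraph_adj`). Two legs of the spider
span at least k + m + 1 = n vertices, so the three edges at the center form a triangle in the next
graph, carrying tails of lengths k - 1, k - 1, m - 1 (`ThreeLegs.hLineGraph`). From then on each
step lengthens every arc of the cycle by 1, because the new cycle detours through the first edge of
each tail, and shortens every tail by 1. The path tail, arc, arc, tail keeps its order, so nothing
is lost until the short tail is used up (`TailedCycle.hLineGraph_three`). What remains is a cycle of
length 3m with two tails of length k - m ≥ 1. Cycle length plus tail length is n + m - 1 ≥ n and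
grows by 1 at each step, so the process continues (`TailedCycle.hLineGraph_two`). When the tails
vanish, the triangle at a former branch vertex leaves a chord on a cycle of length at least n. A
chorded cycle of length l ≥ n yields one of length l + 1 (`ChordedCycle.hLineGraph`), so the orders
are unbounded. -/

/-! ### Adjacency in the path-line graph -/

/-- `u, v, w` are consecutive vertices of a path of `G` with at least `n` vertices. -/
def OnPath {V : Type u} (n : ℕ) (G : SimpleGraph V) (u v w : V) : Prop :=
  ∃ (p : ℤ → V) (lo hi : ℤ), (n : ℤ) ≤ hi - lo ∧
    (∀ x y, lo ≤ x → x < hi → lo ≤ y → y < hi → p x = p y → x = y) ∧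
    (∀ x, lo ≤ x → x + 1 < hi → G.Adj (p x) (p (x + 1))) ∧
    ∃ j, lo ≤ j ∧ j + 2 < hi ∧ p j = u ∧ p (j + 1) = v ∧ p (j + 2) = w

theorem OnPath.hLineGraph_adj {V : Type u} {n : ℕ} {G : SimpleGraph V} {u v w : V}
    (hn : 3 ≤ n) (h : OnPath n G u v w) {e f : G.edgeSet} (he : (e : Sym2 V) = s(u, v))
    (hf : (f : Sym2 V) = s(v, w)) :
    (HLineGraph (SimpleGraph.pathGraph n) G).Adj e f := by
  obtain ⟨p, lo, hi, hlen, inj, adj, j, hj, hj', rfl, rfl, rfl⟩ := h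
  -- A window of exactly `n` indices around `j, j + 1, j + 2`: it starts at `j` unless that overruns
  -- `hi`, and then it ends at `hi`.
  obtain ⟨a, ha, haj, haj', han⟩ : ∃ a, lo ≤ a ∧ a ≤ j ∧ j + 2 < a + n ∧ a + n ≤ hi := by
    by_cases hc : j + n ≤ hi
    · exact ⟨j, by omega, by omega, by omega, by omega⟩
    · exact ⟨hi - n, by omega, by omega, by omega, by omega⟩
  have hne : e ≠ f := by
    intro hef
    have h1 : s(p j, p (j + 1)) = s(p (j + 1), p (j + 2)) := by rw [← he, ← hf, hef]
    rw [Sym2.eq_iff] at h1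
    rcases h1 with h1 | h1
    · have := inj _ _ (by omega) (by omega) (by omega) (by omega) h1.1
      omega
    · have := inj _ _ (by omega) (by omega) (by omega) (by omega) h1.1
      omega
  refine ⟨?_, ?_⟩
  · rw [SimpleGraph.lineGraph_adj_iff_exists]
    exact ⟨hne, p (j + 1), by simp [he], by simp [hf]⟩
  · let φ : SimpleGraph.pathGraph n →g G :=
      ⟨fun x => p (a + (x : ℕ)), by
        intro x y hxy
        rw [SimpleGraph.pathGraph_adj] at hxy
        have := x.isLt
        have := y.isLt
        rcases hxy with hxy | hxy
        · have h2 : a + ((y : ℕ) : ℤ) = a + ((x : ℕ) : ℤ) + 1 := by omega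
          rw [h2]
          exact adj _ (by omega) (by omega)
        · have h2 : a + ((x : ℕ) : ℤ) = a + ((y : ℕ) : ℤ) + 1 := by omega
          rw [h2]
          exact (adj _ (by omega) (by omega)).symm⟩
    let C : SimpleGraph.Copy (SimpleGraph.pathGraph n) G := ⟨φ, by
      intro x y hxy
      have := x.isLt
      have := y.isLt
      have := inj _ _ (by omega) (by omega) (by omega) (by omega) hxy
      exact Fin.ext (by omega)⟩
    have key : ∀ x : ℤ, a ≤ x → x + 1 < a + n → s(p x, p (x + 1)) ∈ C.toSubgraph.edgeSet := by
      intro x hx hx'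
      rw [SimpleGraph.Subgraph.mem_edgeSet]
      refine (SimpleGraph.Subgraph.map_adj ..).mpr
        ⟨⟨(x - a).toNat, by omega⟩, ⟨(x + 1 - a).toNat, by omega⟩, ?_, ?_, ?_⟩
      · simp only [SimpleGraph.Subgraph.top_adj]
        rw [SimpleGraph.pathGraph_adj]
        left
        simp only
        omega
      · change p _ = _
        congr 1
        simp only
        omega
      · change p _ = _
        congr 1
        simp only
        omega
    refine ⟨C.toSubgraph, ⟨C.isoToSubgraph⟩, ?_, ?_⟩
    · rw [he]; exact key j (by omega) (by omega)
    · rw [hf]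
      have := key (j + 1) (by omega) (by omega)
      rwa [add_assoc] at this

/-! ### Cycles with tails -/

/-- A cycle with tails: the cycle runs through the vertices `w i 0`, from `w i 0` to `w (next i) 0`
along an arc of length `a i`, and at `w i 0` there is a tail with `t i` further vertices. -/
structure TailedCycle {V : Type u} {ι : Type} (G : SimpleGraph V) (next : ι → ι) (a t : ι → ℤ)
    (w : ι → ℤ → V) : Prop where
  arc_pos : ∀ i, 1 ≤ a i
  tail_nonneg : ∀ i, 0 ≤ t i
  glue : ∀ i, w i (a i) = w (next i) 0
  adj : ∀ i j, -t i ≤ j → j < a i → G.Adj (w i j) (w i (j + 1))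
  inj : ∀ i j i' j', -t i ≤ j → j < a i → -t i' ≤ j' → j' < a i' → w i j = w i' j' →
    i = i' ∧ j = j'

/-- At each branch vertex the new cycle passes from the last arc edge to the first tail edge and on
to the next arc, which gains one vertex per arc and costs one per tail. `hdigon` excludes two arcs
that are one and the same edge. -/
theorem TailedCycle.hLineGraph {V : Type u} {ι : Type} {n : ℕ} {G : SimpleGraph V}
    {next : ι → ι} {a t : ι → ℤ} {w : ι → ℤ → V} (h : TailedCycle G next a t w) [Nonempty ι]
    (hn : 3 ≤ n) (ht : ∀ i, 1 ≤ t i) (hnext : ∀ i, next i ≠ i)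
    (hdigon : ∀ i, a i = 1 → a (next i) = 1 → next (next i) ≠ i)
    (hleg : ∀ i j, 1 - t i ≤ j → j < a i → OnPath n G (w i (j - 1)) (w i j) (w i (j + 1)))
    (hjoin : ∀ i, OnPath n G (w i (a i - 1)) (w (next i) 0) (w (next i) (-1))) :
    ∃ w' : ι → ℤ → G.edgeSet,
      TailedCycle (HLineGraph (SimpleGraph.pathGraph n) G) next (fun i => a i + 1)
        (fun i => t i - 1) w' ∧
      ∀ i j, 1 - t i ≤ j → j ≤ a i → (w' i j : Sym2 V) = s(w i (j - 1), w i j) := by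
  classical
  have hedge : ∀ i j, 1 - t i ≤ j → j ≤ a i → s(w i (j - 1), w i j) ∈ G.edgeSet := by
    intro i j h1 h2
    have := h.adj i (j - 1) (by omega) (by omega)
    rwa [sub_add_cancel] at this
  obtain ⟨i₀⟩ := ‹Nonempty ι›
  have h0 := ht i₀
  have h0' := h.arc_pos i₀
  -- Outside its range `W i j` is the first tail edge at `w (next i) 0`, which provides the gluing
  -- at `a i + 1`. The last branch only makes the function total.
  let W : ι → ℤ → G.edgeSet := fun i j =>
    if hj : 1 - t i ≤ j ∧ j ≤ a i then ⟨s(w i (j - 1), w i j), hedge i j hj.1 hj.2⟩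
    else if h1 : 1 - t (next i) ≤ 0 ∧ 0 ≤ a (next i) then
      ⟨s(w (next i) (0 - 1), w (next i) 0), hedge _ _ h1.1 h1.2⟩
    else ⟨s(w i₀ (0 - 1), w i₀ 0), hedge i₀ 0 (by omega) (by omega)⟩
  have hW : ∀ i j, 1 - t i ≤ j → j ≤ a i → (W i j : Sym2 V) = s(w i (j - 1), w i j) := by
    intro i j h1 h2
    simp only [W]
    rw [dif_pos ⟨h1, h2⟩]
  have hglue : ∀ i, W i (a i + 1) = W (next i) 0 := by
    intro i
    have h1 := ht (next i)
    have h2 := h.arc_pos (next i)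
    simp only [W]
    rw [dif_neg (by omega), dif_pos (by omega), dif_pos (by omega)]
  refine ⟨W, ⟨fun i => ?_, fun i => ?_, hglue, ?_, ?_⟩, hW⟩
  · have := h.arc_pos i
    omega
  · have := ht i
    omega
  · intro i j h1 h2
    rcases lt_or_eq_of_le (show j ≤ a i by omega) with h3 | rfl
    · refine (hleg i j (by omega) h3).hLineGraph_adj hn (hW i j (by omega) h3.le) ?_
      rw [hW i (j + 1) (by omega) (by omega), add_sub_cancel_right]
    · rw [hglue]
      have := ht (next i)
      have := h.arc_pos (next i)
      refine (hjoin i).hLineGraph_adj hn ?_ ?_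
      · rw [hW i (a i) (by omega) le_rfl, h.glue]
      · rw [hW _ 0 (by omega) (by omega), Sym2.eq_swap, zero_sub]
  · intro i j i' j' h1 h2 h3 h4 he
    have he' := congrArg Subtype.val he
    rw [hW i j (by omega) (by omega), hW i' j' (by omega) (by omega), Sym2.eq_iff] at he'
    rcases he' with he' | ⟨e1, e2⟩
    · have := h.inj _ _ _ _ (by omega) (by omega) (by omega) (by omega) he'.1
      exact ⟨this.1, by omega⟩
    · exfalso
      have hi := ht i
      have hi' := ht i'
      rcases lt_or_eq_of_le (show j' ≤ a i' by omega) with h5 | rfl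
      · obtain ⟨rfl, h6⟩ := h.inj _ _ _ _ (by omega) (by omega) (by omega) (by omega) e1
        rcases lt_or_eq_of_le (show j ≤ a i by omega) with h7 | rfl
        · have := h.inj _ _ _ _ (by omega) (by omega) (by omega) (by omega) e2
          omega
        · rw [h.glue] at e2
          have h8 := ht (next i)
          have h9 := h.arc_pos (next i)
          exact hnext i (h.inj _ _ _ _ (by omega) (by omega) (by omega) (by omega) e2).1
      · rw [h.glue] at e1
        have h8 := ht (next i')
        have h9 := h.arc_pos (next i')
        have h10 := h.arc_pos i'
        obtain ⟨rfl, h6⟩ := h.inj _ _ _ _ (by omega) (by omega) (by omega) (by omega) e1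
        obtain rfl : j = 1 := by omega
        rcases lt_or_eq_of_le h9 with h7 | h7
        · exact hnext i' (h.inj _ _ _ _ (by omega) (by omega) (by omega) (by omega) e2).1
        · rw [h7, h.glue] at e2
          have h11 := ht (next (next i'))
          have h12 := h.arc_pos (next (next i'))
          obtain ⟨h13, h14⟩ := h.inj _ _ _ _ (by omega) (by omega) (by omega) (by omega) e2
          exact hdigon i' (by omega) h7.symm h13

/-- The path runs in along one tail, through two arcs, and out along the third tail. -/
theorem TailedCycle.exists_path_three {V : Type u} {ι : Type} {G : SimpleGraph V}
    {next : ι → ι} {a t : ι → ℤ} {w : ι → ℤ → V} (h : TailedCycle G next a t w) (i : ι)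
    (h1 : next i ≠ i) (h2 : next (next i) ≠ next i) (h3 : next (next i) ≠ i) :
    ∃ p : ℤ → V,
      (∀ x y, -t i ≤ x → x < a i + a (next i) + t (next (next i)) + 1 → -t i ≤ y →
        y < a i + a (next i) + t (next (next i)) + 1 → p x = p y → x = y) ∧
      (∀ x, -t i ≤ x → x + 1 < a i + a (next i) + t (next (next i)) + 1 →
        G.Adj (p x) (p (x + 1))) ∧
      (∀ x, x ≤ a i → p x = w i x) ∧
      (∀ x, 0 ≤ x → x ≤ a (next i) → p (a i + x) = w (next i) x) ∧
      (∀ x, 0 ≤ x → p (a i + a (next i) + x) = w (next (next i)) (-x)) := by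
  classical
  have a0 := h.arc_pos i
  have a1 := h.arc_pos (next i)
  have a2 := h.arc_pos (next (next i))
  have t0 := h.tail_nonneg i
  have t1 := h.tail_nonneg (next i)
  have t2 := h.tail_nonneg (next (next i))
  let p : ℤ → V := fun x => if x < a i then w i x else
    if x < a i + a (next i) then w (next i) (x - a i) else
      w (next (next i)) (-(x - a i - a (next i)))
  have p0 : ∀ x, x ≤ a i → p x = w i x := by
    intro x hx
    rcases lt_or_eq_of_le hx with hx | rfl
    · simp only [p]
      rw [if_pos hx]
    · simp only [p]
      rw [if_neg (by omega), if_pos (by omega), h.glue, sub_self]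
  have p1 : ∀ x, 0 ≤ x → x ≤ a (next i) → p (a i + x) = w (next i) x := by
    intro x hx hx'
    simp only [p]
    rcases lt_or_eq_of_le hx' with hx' | rfl
    · rw [if_neg (by omega), if_pos (by omega), add_sub_cancel_left]
    · rw [if_neg (by omega), if_neg (by omega), h.glue]
      congr 1
      ring
  have p2 : ∀ x, 0 ≤ x → p (a i + a (next i) + x) = w (next (next i)) (-x) := by
    intro x hx
    simp only [p]
    rw [if_neg (by omega), if_neg (by omega)]
    congr 1
    ring
  refine ⟨p, ?_, ?_, p0, p1, p2⟩
  · intro x y hx hx' hy hy' hxy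
    simp only [p] at hxy
    split_ifs at hxy
    all_goals
      obtain ⟨e1, e2⟩ := h.inj _ _ _ _ (by omega) (by omega) (by omega) (by omega) hxy
      first
        | omega
        | exact absurd e1 h1
        | exact absurd e1.symm h1
        | exact absurd e1 h2
        | exact absurd e1.symm h2
        | exact absurd e1 h3
        | exact absurd e1.symm h3
  · intro x hx hx'
    rcases lt_or_ge x (a i) with hc | hc
    · rw [p0 x hc.le, p0 (x + 1) (by omega)]
      exact h.adj _ _ hx hc
    rcases lt_or_ge x (a i + a (next i)) with hd | hd
    · have e1 := p1 (x - a i) (by omega) (by omega)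
      have e2 := p1 (x - a i + 1) (by omega) (by omega)
      rw [show a i + (x - a i) = x by ring] at e1
      rw [show a i + (x - a i + 1) = x + 1 by ring] at e2
      rw [e1, e2]
      exact h.adj _ _ (by omega) (by omega)
    · have e1 := p2 (x - a i - a (next i)) (by omega)
      have e2 := p2 (x - a i - a (next i) + 1) (by omega)
      rw [show a i + a (next i) + (x - a i - a (next i)) = x by ring] at e1
      rw [show a i + a (next i) + (x - a i - a (next i) + 1) = x + 1 by ring] at e2
      rw [e1, e2]
      have := h.adj (next (next i)) (-(x - a i - a (next i) + 1)) (by omega) (by omega)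
      rw [show -(x - a i - a (next i) + 1) + 1 = -(x - a i - a (next i)) by ring] at this
      exact this.symm

/-- The path tail, arc, arc, tail has (K i - d) + d + d + (K j - d) + 1 = K i + K j + 1 vertices,
whatever `d` is. -/
theorem TailedCycle.hLineGraph_three {V : Type u} {n : ℕ} {G : SimpleGraph V}
    {K : Fin 3 → ℤ} {d : ℤ} {w : Fin 3 → ℤ → V}
    (h : TailedCycle G (fun i => i + 1) (fun _ => d) (fun i => K i - d) w)
    (hn : 3 ≤ n) (hK : ∀ i, d + 1 ≤ K i) (hlen : ∀ i j, i ≠ j → (n : ℤ) ≤ K i + K j + 1) :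
    ∃ w', TailedCycle (HLineGraph (SimpleGraph.pathGraph n) G) (fun i => i + 1)
      (fun _ => d + 1) (fun i => K i - (d + 1)) w' := by
  have f1 : ∀ i : Fin 3, i + 1 ≠ i := by decide
  have f2 : ∀ i : Fin 3, i + 1 + 1 ≠ i := by decide
  have f3 : ∀ i : Fin 3, i + 1 + 1 + 1 = i := by decide
  have d1 := h.arc_pos 0
  have hleg : ∀ i j, 1 - (K i - d) ≤ j → j < d →
      OnPath n G (w i (j - 1)) (w i j) (w i (j + 1)) := by
    intro i j hj hj'
    obtain ⟨p, pi, pa, p0, p1, p2⟩ := h.exists_path_three i (f1 i) (f1 _) (f2 i)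
    have k1 := hK i
    have k2 := hK (i + 1 + 1)
    have k3 := hlen i (i + 1 + 1) (f2 i).symm
    refine ⟨p, _, _, ?_, pi, pa, j - 1, by omega, by omega, p0 _ (by omega), ?_, ?_⟩
    · omega
    · rw [sub_add_cancel]
      exact p0 _ (by omega)
    · rw [show j - 1 + 2 = j + 1 by ring]
      exact p0 _ (by omega)
  have hjoin : ∀ i, OnPath n G (w i (d - 1)) (w (i + 1) 0) (w (i + 1) (-1)) := by
    intro i
    -- Starting one tail earlier makes arc `i` the second arc, after which the path leaves along the
    -- tail at `i + 1`.
    obtain ⟨p, pi, pa, p0, p1, p2⟩ := h.exists_path_three (i + 1 + 1) (f1 _) (f1 _) (f2 _)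
    rw [f3] at pi pa p1 p2
    have k1 := hK (i + 1)
    have k2 := hK (i + 1 + 1)
    have k3 := hlen (i + 1) (i + 1 + 1) (f1 (i + 1)).symm
    refine ⟨p, _, _, ?_, pi, pa, d + (d - 1), by omega, by omega, p1 _ (by omega) (by omega),
      ?_, ?_⟩
    · omega
    · have := p2 0 le_rfl
      rw [neg_zero] at this
      rw [← this]
      congr 1
      ring
    · rw [← p2 1 (by omega)]
      congr 1
      ring
  obtain ⟨w', h', -⟩ := h.hLineGraph hn (fun i => by have := hK i; omega) f1
    (fun i _ _ => f2 i) hleg hjoin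
  refine ⟨w', ?_⟩
  convert h' using 2
  ring

/-- The path along a tail, through the next arc and up to the end of the following arc. -/
theorem TailedCycle.exists_path_two {V : Type u} {ι : Type} {G : SimpleGraph V}
    {next : ι → ι} {a t : ι → ℤ} {w : ι → ℤ → V} (h : TailedCycle G next a t w) (i : ι)
    (h1 : next i ≠ i) :
    ∃ p : ℤ → V,
      (∀ x y, -t i ≤ x → x < a i + a (next i) → -t i ≤ y →
        y < a i + a (next i) → p x = p y → x = y) ∧
      (∀ x, -t i ≤ x → x + 1 < a i + a (next i) → G.Adj (p x) (p (x + 1))) ∧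
      (∀ x, x ≤ a i → p x = w i x) ∧
      (∀ x, 0 ≤ x → p (a i + x) = w (next i) x) := by
  classical
  have a0 := h.arc_pos i
  have a1 := h.arc_pos (next i)
  have t0 := h.tail_nonneg i
  have t1 := h.tail_nonneg (next i)
  let p : ℤ → V := fun x => if x < a i then w i x else w (next i) (x - a i)
  have p0 : ∀ x, x ≤ a i → p x = w i x := by
    intro x hx
    rcases lt_or_eq_of_le hx with hx | rfl
    · simp only [p]
      rw [if_pos hx]
    · simp only [p]
      rw [if_neg (by omega), h.glue, sub_self]
  have p1 : ∀ x, 0 ≤ x → p (a i + x) = w (next i) x := by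
    intro x hx
    simp only [p]
    rw [if_neg (by omega), add_sub_cancel_left]
  refine ⟨p, ?_, ?_, p0, p1⟩
  · intro x y hx hx' hy hy' hxy
    simp only [p] at hxy
    split_ifs at hxy
    all_goals
      obtain ⟨e1, e2⟩ := h.inj _ _ _ _ (by omega) (by omega) (by omega) (by omega) hxy
      first
        | omega
        | exact absurd e1 h1
        | exact absurd e1.symm h1
  · intro x hx hx'
    rcases lt_or_ge x (a i) with hc | hc
    · rw [p0 x hc.le, p0 (x + 1) (by omega)]
      exact h.adj _ _ hx hc
    · have e1 := p1 (x - a i) (by omega)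
      have e2 := p1 (x - a i + 1) (by omega)
      rw [show a i + (x - a i) = x by ring] at e1
      rw [show a i + (x - a i + 1) = x + 1 by ring] at e2
      rw [e1, e2]
      exact h.adj _ _ (by omega) (by omega)

/-- The path along a tail and then backwards around the whole cycle of a cycle with two tails. -/
theorem TailedCycle.exists_path_two_reverse {V : Type u} {ι : Type} {G : SimpleGraph V}
    {next : ι → ι} {a t : ι → ℤ} {w : ι → ℤ → V} (h : TailedCycle G next a t w) (i : ι)
    (h1 : next i ≠ i) (h2 : next (next i) = i) :
    ∃ p : ℤ → V,
      (∀ x y, 1 ≤ x → x < a i + a (next i) + t i + 1 → 1 ≤ y →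
        y < a i + a (next i) + t i + 1 → p x = p y → x = y) ∧
      (∀ x, 1 ≤ x → x + 1 < a i + a (next i) + t i + 1 → G.Adj (p x) (p (x + 1))) ∧
      (∀ x, 0 ≤ x → x ≤ a (next i) → p (a i + x) = w (next i) x) ∧
      (∀ x, 0 ≤ x → p (a i + a (next i) + x) = w i (-x)) := by
  classical
  have a0 := h.arc_pos i
  have a1 := h.arc_pos (next i)
  have t0 := h.tail_nonneg i
  have t1 := h.tail_nonneg (next i)
  let p : ℤ → V := fun x => if x < a i then w i x else
    if x < a i + a (next i) then w (next i) (x - a i) else w i (-(x - a i - a (next i)))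
  have p0 : ∀ x, x ≤ a i → p x = w i x := by
    intro x hx
    rcases lt_or_eq_of_le hx with hx | rfl
    · simp only [p]
      rw [if_pos hx]
    · simp only [p]
      rw [if_neg (by omega), if_pos (by omega), h.glue, sub_self]
  have p1 : ∀ x, 0 ≤ x → x ≤ a (next i) → p (a i + x) = w (next i) x := by
    intro x hx hx'
    simp only [p]
    rcases lt_or_eq_of_le hx' with hx' | rfl
    · rw [if_neg (by omega), if_pos (by omega), add_sub_cancel_left]
    · rw [if_neg (by omega), if_neg (by omega), h.glue, h2]
      congr 1
      ring
  have p2 : ∀ x, 0 ≤ x → p (a i + a (next i) + x) = w i (-x) := by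
    intro x hx
    simp only [p]
    rw [if_neg (by omega), if_neg (by omega)]
    congr 1
    ring
  refine ⟨p, ?_, ?_, p1, p2⟩
  · intro x y hx hx' hy hy' hxy
    simp only [p] at hxy
    split_ifs at hxy
    all_goals
      obtain ⟨e1, e2⟩ := h.inj _ _ _ _ (by omega) (by omega) (by omega) (by omega) hxy
      first
        | omega
        | exact absurd e1 h1
        | exact absurd e1.symm h1
  · intro x hx hx'
    rcases lt_or_ge x (a i) with hc | hc
    · rw [p0 x hc.le, p0 (x + 1) (by omega)]
      exact h.adj _ _ (by omega) hc
    rcases lt_or_ge x (a i + a (next i)) with hd | hd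
    · have e1 := p1 (x - a i) (by omega) (by omega)
      have e2 := p1 (x - a i + 1) (by omega) (by omega)
      rw [show a i + (x - a i) = x by ring] at e1
      rw [show a i + (x - a i + 1) = x + 1 by ring] at e2
      rw [e1, e2]
      exact h.adj _ _ (by omega) (by omega)
    · have e1 := p2 (x - a i - a (next i)) (by omega)
      have e2 := p2 (x - a i - a (next i) + 1) (by omega)
      rw [show a i + a (next i) + (x - a i - a (next i)) = x by ring] at e1
      rw [show a i + a (next i) + (x - a i - a (next i) + 1) = x + 1 by ring] at e2
      rw [e1, e2]
      have := h.adj i (-(x - a i - a (next i) + 1)) (by omega) (by omega)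
      rw [show -(x - a i - a (next i) + 1) + 1 = -(x - a i - a (next i)) by ring] at this
      exact this.symm

/-- The second conclusion is the third side of the triangle at `w i 0`: it bypasses the tail edge
and later serves as the chord. -/
theorem TailedCycle.hLineGraph_two {V : Type u} {ι : Type} [Nonempty ι] {n : ℕ}
    {G : SimpleGraph V} {next : ι → ι} {a : ι → ℤ} {t : ℤ} {w : ι → ℤ → V}
    (h : TailedCycle G next a (fun _ => t) w) (hn : 3 ≤ n) (ht : 1 ≤ t)
    (hnext : ∀ i, next i ≠ i) (hnext' : ∀ i, next (next i) = i)
    (ha : ∀ i, 3 ≤ a i + a (next i)) (hlen : ∀ i, n ≤ a i + a (next i) + t) :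
    ∃ w', TailedCycle (HLineGraph (SimpleGraph.pathGraph n) G) next (fun i => a i + 1)
        (fun _ => t - 1) w' ∧
      ∀ i, 2 ≤ a i →
        (HLineGraph (SimpleGraph.pathGraph n) G).Adj (w' (next i) (a (next i))) (w' i 1) := by
  have hjoin : ∀ i, OnPath n G (w i (a i - 1)) (w (next i) 0) (w (next i) (-1)) := by
    intro i
    obtain ⟨p, pi, pa, p1, p2⟩ := h.exists_path_two_reverse (next i) (hnext _) (hnext' _)
    rw [hnext'] at pi pa p1 p2
    have l1 := hlen i
    have a0 := h.arc_pos i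
    have a1 := h.arc_pos (next i)
    have a2 := ha i
    refine ⟨p, _, _, ?_, pi, pa, a (next i) + (a i - 1), by omega, by omega,
      p1 _ (by omega) (by omega), ?_, ?_⟩
    · omega
    · have := p2 0 le_rfl
      rw [neg_zero] at this
      rw [← this]
      congr 1
      ring
    · rw [← p2 1 (by omega)]
      congr 1
      ring
  have hleg : ∀ i j, 1 - t ≤ j → j < a i →
      OnPath n G (w i (j - 1)) (w i j) (w i (j + 1)) := by
    intro i j hj hj'
    obtain ⟨p, pi, pa, p0, p1⟩ := h.exists_path_two i (hnext _)
    have l1 := hlen i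
    have a1 := h.arc_pos (next i)
    refine ⟨p, _, _, ?_, pi, pa, j - 1, by omega, by omega, p0 _ (by omega), ?_, ?_⟩
    · omega
    · rw [sub_add_cancel]
      exact p0 _ (by omega)
    · rw [show j - 1 + 2 = j + 1 by ring]
      exact p0 _ (by omega)
  obtain ⟨w', h', hw'⟩ := h.hLineGraph hn (fun _ => ht) hnext
    (fun i h1 h2 => by have := ha i; omega) hleg hjoin
  refine ⟨w', h', fun i hi => ?_⟩
  have a1 := h.arc_pos (next i)
  obtain ⟨p, pi, pa, p0, p1⟩ := h.exists_path_two (next i) (hnext _)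
  rw [hnext'] at pi pa p1
  have hon : OnPath n G (w (next i) (a (next i) - 1)) (w i 0) (w i 1) := by
    have l1 := hlen i
    refine ⟨p, _, _, ?_, pi, pa, a (next i) - 1, by omega, by omega, p0 _ (by omega), ?_, ?_⟩
    · omega
    · rw [← p1 0 (by omega)]
      congr 1
      ring
    · rw [← p1 1 (by omega)]
      congr 1
      ring
  refine hon.hLineGraph_adj hn ?_ ?_
  · rw [hw' _ _ (by omega) le_rfl, h.glue, hnext']
  · rw [hw' _ _ (by omega) (by omega), sub_self]

/-! ### Chorded cycles and their unbounded growth -/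

/-- A cycle `c 0, …, c (l - 1)` with a chord joining `c 0` to `c 2`. -/
structure ChordedCycle {V : Type u} (G : SimpleGraph V) (l : ℤ) (c : ℤ → V) : Prop where
  four_le : 4 ≤ l
  adj : ∀ j, 0 ≤ j → j + 1 < l → G.Adj (c j) (c (j + 1))
  close : G.Adj (c (l - 1)) (c 0)
  chord : G.Adj (c 0) (c 2)
  inj : ∀ i j, 0 ≤ i → i < l → 0 ≤ j → j < l → c i = c j → i = j

/-- The chord becomes an extra vertex of the cycle, inserted between the two cycle edges at `c 0`;
these two are themselves adjacent and form the new chord. Every adjacency needed comes from a path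
through all `l` vertices. -/
theorem ChordedCycle.hLineGraph {V : Type u} {n : ℕ} {G : SimpleGraph V} {l : ℤ} {c : ℤ → V}
    (h : ChordedCycle G l c) (hn : 3 ≤ n) (hl : n ≤ l) :
    ∃ c', ChordedCycle (HLineGraph (SimpleGraph.pathGraph n) G) (l + 1) c' := by
  classical
  have l4 := h.four_le
  have adj0 := h.adj 0 le_rfl (by omega)
  rw [zero_add] at adj0
  have hin : ∀ j, 0 ≤ j → j + 2 < l → OnPath n G (c j) (c (j + 1)) (c (j + 2)) := by
    intro j hj hj'
    exact ⟨c, 0, l, by omega, fun x y h1 h2 h3 h4 => h.inj x y h1 h2 h3 h4, h.adj, j, hj, hj',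
      rfl, rfl, rfl⟩
  have hlast : OnPath n G (c (l - 2)) (c (l - 1)) (c 0) := by
    refine ⟨fun x => if x < l then c x else c 0, 1, l + 1, by omega, ?_, ?_, l - 2, by omega,
      by omega, ?_, ?_, ?_⟩
    · intro x y h1 h2 h3 h4 hxy
      beta_reduce at hxy
      split_ifs at hxy
      all_goals
        have := h.inj _ _ (by omega) (by omega) (by omega) (by omega) hxy
        omega
    · intro x h1 h2
      beta_reduce
      rw [if_pos (by omega)]
      rcases lt_or_eq_of_le (show x + 1 ≤ l by omega) with h3 | h3
      · rw [if_pos h3]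
        exact h.adj _ (by omega) h3
      · rw [if_neg (by omega), show x = l - 1 by omega]
        exact h.close
    · exact if_pos (by omega)
    · beta_reduce
      rw [if_pos (by omega)]
      congr 1
      ring
    · exact if_neg (by omega)
  have hzero : OnPath n G (c (l - 1)) (c 0) (c 1) := by
    refine ⟨fun x => if x < 0 then c (l - 1) else c x, -1, l - 1, by omega, ?_, ?_, -1, by omega,
      by omega, ?_, ?_, ?_⟩
    · intro x y h1 h2 h3 h4 hxy
      beta_reduce at hxy
      split_ifs at hxy
      all_goals
        have := h.inj _ _ (by omega) (by omega) (by omega) (by omega) hxy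
        omega
    · intro x h1 h2
      beta_reduce
      rw [if_neg (show ¬ x + 1 < 0 by omega)]
      split_ifs with h3
      · rw [show x + 1 = 0 by omega]
        exact h.close
      · exact h.adj _ (by omega) (by omega)
    · simp
    · simp
    · simp
  have hchord : OnPath n G (c 1) (c 0) (c 2) := by
    refine ⟨fun x => if x = 0 then c 1 else if x = 1 then c 0 else c x, 0, l, by omega, ?_, ?_,
      0, by omega, by omega, ?_, ?_, ?_⟩
    · intro x y h1 h2 h3 h4 hxy
      beta_reduce at hxy
      split_ifs at hxy
      all_goals
        have := h.inj _ _ (by omega) (by omega) (by omega) (by omega) hxy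
        omega
    · intro x h1 h2
      beta_reduce
      rcases eq_or_ne x 0 with rfl | h3
      · simpa using adj0.symm
      rcases eq_or_ne x 1 with rfl | h4
      · simpa using h.chord
      · rw [if_neg h3, if_neg h4, if_neg (by omega), if_neg (by omega)]
        exact h.adj _ h1 h2
    · simp
    · simp
    · simp
  have hchord' : OnPath n G (c 2) (c 0) (c (l - 1)) := by
    -- The path c 1, c 2, c 0, c (l - 1), …, c 3.
    refine ⟨fun x => if x = 0 then c 1 else if x = 1 then c 2 else if x = 2 then c 0 else
      c (l + 2 - x), 0, l, by omega, ?_, ?_, 1, by omega, by omega, ?_, ?_, ?_⟩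
    · intro x y h1 h2 h3 h4 hxy
      beta_reduce at hxy
      split_ifs at hxy
      all_goals
        have := h.inj _ _ (by omega) (by omega) (by omega) (by omega) hxy
        omega
    · intro x h1 h2
      beta_reduce
      rcases eq_or_ne x 0 with rfl | h3
      · have := h.adj 1 (by omega) (by omega)
        simpa using this
      rcases eq_or_ne x 1 with rfl | h4
      · simpa using h.chord.symm
      rcases eq_or_ne x 2 with rfl | h5
      · have := h.close.symm
        simpa [show l + 2 - 3 = l - 1 by ring] using this
      · rw [if_neg h3, if_neg h4, if_neg h5, if_neg (by omega), if_neg (by omega),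
          if_neg (by omega)]
        have := h.adj (l + 2 - (x + 1)) (by omega) (by omega)
        rw [show l + 2 - (x + 1) + 1 = l + 2 - x by ring] at this
        exact this.symm
    · simp
    · simp
    · simp [show l + 2 - 3 = l - 1 by ring]
  let W : ℤ → G.edgeSet := fun x =>
    if x = 0 then ⟨s(c (l - 1), c 0), h.close⟩
    else if hx : 2 ≤ x ∧ x ≤ l then ⟨s(c (x - 2), c (x - 1)), by
      have := h.adj (x - 2) (by omega) (by omega)
      rwa [show x - 2 + 1 = x - 1 by ring] at this⟩
    else ⟨s(c 0, c 2), h.chord⟩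
  have W0 : (W 0 : Sym2 V) = s(c (l - 1), c 0) := rfl
  have W1 : (W 1 : Sym2 V) = s(c 0, c 2) := rfl
  have W2 : ∀ x, 2 ≤ x → x ≤ l → (W x : Sym2 V) = s(c (x - 2), c (x - 1)) := by
    intro x h1 h2
    simp only [W]
    rw [if_neg (by omega), dif_pos ⟨h1, h2⟩]
  have W2' : (W 2 : Sym2 V) = s(c 0, c 1) := W2 2 le_rfl (by omega)
  have W0' : (W 0 : Sym2 V) = s(c 0, c (l - 1)) := by rw [W0, Sym2.eq_swap]
  have W1' : (W 1 : Sym2 V) = s(c 2, c 0) := by rw [W1, Sym2.eq_swap]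
  have W2'' : (W 2 : Sym2 V) = s(c 1, c 0) := by rw [W2', Sym2.eq_swap]
  have cne : ∀ {a b a' b' : ℤ}, 0 ≤ a → a < b → b < l → 0 ≤ a' → a' < b' → b' < l →
      s(c a, c b) = s(c a', c b') → a = a' ∧ b = b' := by
    intro a b a' b' h1 h2 h3 h4 h5 h6 he
    rw [Sym2.eq_iff] at he
    rcases he with he | he
    · exact ⟨h.inj _ _ (by omega) (by omega) (by omega) (by omega) he.1,
        h.inj _ _ (by omega) (by omega) (by omega) (by omega) he.2⟩
    · have e1 := h.inj _ _ (by omega) (by omega) (by omega) (by omega) he.1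
      have e2 := h.inj _ _ (by omega) (by omega) (by omega) (by omega) he.2
      omega
  have Wlt : ∀ x, 0 ≤ x → x ≤ l → ∃ a b, 0 ≤ a ∧ a < b ∧ b < l ∧ (W x : Sym2 V) = s(c a, c b) ∧
      (x = 0 ∧ a = 0 ∧ b = l - 1 ∨ x = 1 ∧ a = 0 ∧ b = 2 ∨ 2 ≤ x ∧ a = x - 2 ∧ b = x - 1) := by
    intro x h1 h2
    rcases eq_or_ne x 0 with rfl | h3
    · exact ⟨0, l - 1, by omega, by omega, by omega, W0', by omega⟩
    rcases eq_or_ne x 1 with rfl | h4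
    · exact ⟨0, 2, by omega, by omega, by omega, W1, by omega⟩
    · exact ⟨x - 2, x - 1, by omega, by omega, by omega, W2 x (by omega) h2, by omega⟩
  refine ⟨W, by omega, ?_, ?_, hzero.hLineGraph_adj hn W0 W2', ?_⟩
  · intro j h1 h2
    rcases eq_or_ne j 0 with rfl | h3
    · exact (hchord'.hLineGraph_adj hn W1' W0').symm
    rcases eq_or_ne j 1 with rfl | h4
    · exact (hchord.hLineGraph_adj hn W2'' W1).symm
    · have := hin (j - 2) (by omega) (by omega)
      rw [show j - 2 + 1 = j - 1 by ring, sub_add_cancel] at this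
      refine this.hLineGraph_adj hn (W2 j (by omega) (by omega)) ?_
      rw [W2 (j + 1) (by omega) (by omega), add_sub_cancel_right,
        show j + 1 - 2 = j - 1 by ring]
  · rw [add_sub_cancel_right]
    exact hlast.hLineGraph_adj hn (W2 l (by omega) le_rfl) W0
  · intro x y h1 h2 h3 h4 hxy
    obtain ⟨a, b, ha, hab, hb, he, hx⟩ := Wlt x h1 (by omega)
    obtain ⟨a', b', ha', hab', hb', he', hy⟩ := Wlt y h3 (by omega)
    rw [hxy, he'] at he
    have := cne ha' hab' hb' ha hab hb he
    omega

theorem TailedCycle.exists_chordedCycle {V : Type u} {ι : Type} {G : SimpleGraph V}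
    {next : ι → ι} {a t : ι → ℤ} {w : ι → ℤ → V} (h : TailedCycle G next a t w) (i : ι)
    (h1 : next i ≠ i) (h2 : next (next i) = i) (hl : 4 ≤ a i + a (next i)) (hi : 2 ≤ a i)
    (hchord : G.Adj (w (next i) (a (next i) - 1)) (w i 1)) :
    ∃ c, ChordedCycle G (a i + a (next i)) c := by
  classical
  obtain ⟨p, pi, pa, p0, p1⟩ := h.exists_path_two i h1
  have a1 := h.arc_pos (next i)
  have t0 := h.tail_nonneg i
  have e1 := p1 (a (next i) - 1) (by omega)
  rw [← add_sub_assoc] at e1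
  -- The shift by one puts the branch vertex `w i 0` at position 1, between the ends of the chord.
  refine ⟨fun x => if x = 0 then p (a i + a (next i) - 1) else p (x - 1), hl, ?_, ?_, ?_, ?_⟩
  · intro j hj hj'
    rw [if_neg (show ¬ j + 1 = 0 by omega), add_sub_cancel_right]
    split_ifs with h3
    · rw [e1, h3, p0 0 (by omega)]
      have := h.adj (next i) (a (next i) - 1) (by have := h.tail_nonneg (next i); omega) (by omega)
      rwa [sub_add_cancel, h.glue, h2] at this
    · have := pa (j - 1) (by omega) (by omega)
      rwa [sub_add_cancel] at this
  · rw [if_neg (by omega), if_pos rfl]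
    have := pa (a i + a (next i) - 1 - 1) (by omega) (by omega)
    rwa [sub_add_cancel] at this
  · rw [if_pos rfl, if_neg (by omega), e1, show (2 : ℤ) - 1 = 1 by rfl, p0 1 (by omega)]
    exact hchord
  · intro x y _ _ _ _ hxy
    beta_reduce at hxy
    split_ifs at hxy
    all_goals first
      | omega
      | (have := pi _ _ (by omega) (by omega) (by omega) (by omega) hxy; omega)

theorem finite_hLineIter {W : Type v} {V : Type u} [Finite V] (H : SimpleGraph W)
    (G : SimpleGraph V) (i : ℕ) : Finite (HLineIter H G i).1 := by
  induction i with
  | zero => exact ‹Finite V›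
  | succ i ih => exact inferInstanceAs (Finite (HLineIter H G i).2.edgeSet)

theorem ChordedCycle.divergesByOrder {V : Type u} [Finite V] {G : SimpleGraph V} {n i : ℕ} {l : ℤ}
    {c} (h : ChordedCycle (HLineIter (SimpleGraph.pathGraph n) G i).2 l c) (hn : 3 ≤ n)
    (hl : n ≤ l) : DivergesByOrder (SimpleGraph.pathGraph n) G := by
  have key : ∀ s : ℕ,
      ∃ c, ChordedCycle (HLineIter (SimpleGraph.pathGraph n) G (i + s)).2 (l + s) c := by
    intro s
    induction s with
    | zero => exact ⟨c, by simpa using h⟩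
    | succ s ih =>
      obtain ⟨c, hc⟩ := ih
      obtain ⟨c', hc'⟩ := hc.hLineGraph hn (by omega)
      have e : l + ((s + 1 : ℕ) : ℤ) = l + s + 1 := by push_cast; ring
      exact ⟨c', by rw [e]; exact hc'⟩
  intro N _
  obtain ⟨c, hc⟩ := key N
  have := finite_hLineIter (SimpleGraph.pathGraph n) G (i + N)
  refine ⟨i + N, ?_⟩
  have hinj : Function.Injective fun x : Fin N => c x := by
    intro x y hxy
    have := x.isLt
    have := y.isLt
    exact Fin.ext (by
      have := hc.inj x y (by omega) (by omega) (by omega) (by omega) hxy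
      omega)
  simpa using Nat.card_le_card_of_injective _ hinj

/-! ### From two tails to a chorded cycle -/

/-- Induction on the tail length: `a 0 + a 1` grows by 2 while the tail loses 1, so the length bound
persists. The condition on `a 1` provides the chord when the tails disappear. -/
theorem TailedCycle.divergesByOrder_two {V : Type u} [Finite V] {G : SimpleGraph V} {n : ℕ}
    (hn : 3 ≤ n) (s : ℕ) : ∀ (i : ℕ) (a : Fin 2 → ℤ) (w),
    TailedCycle (HLineIter (SimpleGraph.pathGraph n) G i).2 (fun i => i + 1) a
      (fun _ => (s : ℤ) + 1) w → 2 ≤ a 1 → n ≤ a 0 + a 1 + (s + 1) →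
    DivergesByOrder (SimpleGraph.pathGraph n) G := by
  induction s with
  | zero =>
    intro i a w h ha hl
    have a0 := h.arc_pos 0
    obtain ⟨w', h', hc⟩ := h.hLineGraph_two hn (by simp) (by decide) (by decide)
      (by simp [Fin.forall_fin_two]; omega) (by simp [Fin.forall_fin_two]; omega)
    have hc1 := hc 1 ha
    obtain ⟨c, hc⟩ := h'.exists_chordedCycle 1 (by decide) (by decide) (by simp; omega) (by omega)
      (by rw [add_sub_cancel_right]; exact hc1)
    refine ChordedCycle.divergesByOrder (i := i + 1) hc hn ?_
    simp
    omega
  | succ s ih =>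
    intro i a w h ha hl
    have a0 := h.arc_pos 0
    obtain ⟨w', h', -⟩ := h.hLineGraph_two hn (by omega) (by decide) (by decide)
      (by simp [Fin.forall_fin_two]; omega) (by simp [Fin.forall_fin_two]; omega)
    refine ih (i + 1) (fun i => a i + 1) w' ?_ (by omega) (by push_cast at hl; omega)
    have e : ((s + 1 : ℕ) : ℤ) + 1 - 1 = s + 1 := by push_cast; ring
    rw [e] at h'
    exact h'

/-- Forgetting the last tail of a cycle with three equally spaced tails. -/
theorem TailedCycle.forget_tail {V : Type u} {G : SimpleGraph V} {d t : ℤ} {t' : Fin 3 → ℤ}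
    {w : Fin 3 → ℤ → V} (h : TailedCycle G (fun i => i + 1) (fun _ => d) t' w)
    (h0 : t' 0 = t) (h1 : t' 1 = t) :
    ∃ w' : Fin 2 → ℤ → V, TailedCycle G (fun i => i + 1) ![d, 2 * d] (fun _ => t) w' := by
  classical
  have d1 := h.arc_pos 0
  have t0 := h.tail_nonneg 0
  have t2 := h.tail_nonneg 2
  have g0 : w 0 d = w 1 0 := h.glue 0
  have g1 : w 1 d = w 2 0 := h.glue 1
  have g2 : w 2 d = w 0 0 := h.glue 2
  refine ⟨![w 0, fun x => if x < d then w 1 x else w 2 (x - d)], ?_, ?_, ?_, ?_, ?_⟩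
  · simp [Fin.forall_fin_two]
    omega
  · intro _
    omega
  · rw [Fin.forall_fin_two]
    constructor
    · change w 0 d = if 0 < d then w 1 0 else _
      rw [if_pos (by omega), g0]
    · change (if 2 * d < d then w 1 (2 * d) else w 2 (2 * d - d)) = w 0 0
      rw [if_neg (by omega), ← g2]
      congr 1
      ring
  · rw [Fin.forall_fin_two]
    constructor
    · intro j hj hj'
      exact h.adj 0 j (by omega) hj'
    · intro j hj hj'
      change j < 2 * d at hj'
      change G.Adj (if j < d then w 1 j else w 2 (j - d))
        (if j + 1 < d then w 1 (j + 1) else w 2 (j + 1 - d))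
      rcases lt_trichotomy (j + 1) d with h3 | h3 | h3
      · rw [if_pos (by omega), if_pos h3]
        exact h.adj 1 j (by omega) (by omega)
      · rw [if_pos (by omega), if_neg (by omega), h3, sub_self, ← g1]
        have := h.adj 1 j (by omega) (by omega)
        rwa [h3] at this
      · rw [if_neg (by omega), if_neg (by omega)]
        have := h.adj 2 (j - d) (by omega) (by omega)
        rwa [show j - d + 1 = j + 1 - d by ring] at this
  · have i01 : (0 : Fin 3) ≠ 1 := by decide
    have i02 : (0 : Fin 3) ≠ 2 := by decide
    have i12 : (1 : Fin 3) ≠ 2 := by decide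
    have i10 := i01.symm
    have i20 := i02.symm
    have i21 := i12.symm
    intro i j i' j'
    revert i i'
    rw [Fin.forall_fin_two]
    simp only [Fin.forall_fin_two, Matrix.cons_val_zero, Matrix.cons_val_one]
    refine ⟨⟨?_, ?_⟩, ?_, ?_⟩
    all_goals
      intro b1 b2 b3 b4 he
      try split_ifs at he
      all_goals
        obtain ⟨e1, e2⟩ := h.inj _ _ _ _ (by omega) (by omega) (by omega) (by omega) he
        first
          | contradiction
          | exact ⟨trivial, by omega⟩

/-! ### The spider and its first iterate -/

/-- Three legs with a common vertex `v i 0`, the `i`-th one of length `K i`. -/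
structure ThreeLegs {V : Type u} (G : SimpleGraph V) (K : Fin 3 → ℤ) (v : Fin 3 → ℤ → V) :
    Prop where
  center : ∀ i j, v i 0 = v j 0
  adj : ∀ i j, 0 ≤ j → j < K i → G.Adj (v i j) (v i (j + 1))
  inj : ∀ i j i' j', 0 ≤ j → j ≤ K i → 0 ≤ j' → j' ≤ K i' → v i j = v i' j' →
    j = j' ∧ (j = 0 ∨ i = i')

theorem ThreeLegs.exists_path {V : Type u} {G : SimpleGraph V} {K : Fin 3 → ℤ}
    {v : Fin 3 → ℤ → V} (h : ThreeLegs G K v) {i j : Fin 3} (hij : i ≠ j) :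
    ∃ p : ℤ → V,
      (∀ x y, -K i ≤ x → x < K j + 1 → -K i ≤ y → y < K j + 1 → p x = p y → x = y) ∧
      (∀ x, -K i ≤ x → x + 1 < K j + 1 → G.Adj (p x) (p (x + 1))) ∧
      (∀ x, x ≤ 0 → p x = v i (-x)) ∧ (∀ x, 0 ≤ x → p x = v j x) := by
  classical
  let p : ℤ → V := fun x => if x ≤ 0 then v i (-x) else v j x
  have p0 : ∀ x, x ≤ 0 → p x = v i (-x) := fun x hx => if_pos hx
  have p1 : ∀ x, 0 ≤ x → p x = v j x := by
    intro x hx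
    rcases eq_or_lt_of_le hx with rfl | hx
    · rw [p0 0 le_rfl, neg_zero, h.center i j]
    · exact if_neg (by omega)
  refine ⟨p, ?_, ?_, p0, p1⟩
  · intro x y _ _ _ _ hxy
    simp only [p] at hxy
    split_ifs at hxy
    all_goals
      obtain ⟨e1, e2⟩ := h.inj _ _ _ _ (by omega) (by omega) (by omega) (by omega) hxy
      omega
  · intro x hx hx'
    rcases lt_or_ge x 0 with h0 | h0
    · rw [p0 x h0.le, p0 (x + 1) (by omega)]
      have := h.adj i (-(x + 1)) (by omega) (by omega)
      rw [show -(x + 1) + 1 = -x by ring] at this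
      exact this.symm
    · rw [p1 x h0, p1 (x + 1) (by omega)]
      exact h.adj j x h0 (by omega)

theorem ThreeLegs.hLineGraph {V : Type u} {n : ℕ} {G : SimpleGraph V} {K : Fin 3 → ℤ}
    {v : Fin 3 → ℤ → V} (h : ThreeLegs G K v) (hn : 3 ≤ n) (hK : ∀ i, 1 ≤ K i)
    (hlen : ∀ i j, i ≠ j → (n : ℤ) ≤ K i + K j + 1) :
    ∃ w, TailedCycle (HLineGraph (SimpleGraph.pathGraph n) G) (fun i => i + 1)
      (fun _ => 1) (fun i => K i - 1) w := by
  classical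
  have f1 : ∀ i : Fin 3, i ≠ i + 1 := by decide
  have hedge : ∀ i j, 1 - K i ≤ j → j ≤ 0 → s(v i (-j + 1), v i (-j)) ∈ G.edgeSet := by
    intro i j h1 h2
    exact (h.adj i (-j) (by omega) (by omega)).symm
  have hedge0 : ∀ i, s(v i (-0 + 1), v i (-0)) ∈ G.edgeSet := fun i =>
    hedge i 0 (by have := hK i; omega) le_rfl
  -- Index 0 is the edge at the center and negative indices move outwards. The default value gives
  -- the gluing at index 1.
  let W : Fin 3 → ℤ → G.edgeSet := fun i j =>
    if hj : 1 - K i ≤ j ∧ j ≤ 0 then ⟨s(v i (-j + 1), v i (-j)), hedge i j hj.1 hj.2⟩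
    else ⟨_, hedge0 (i + 1)⟩
  have hW : ∀ i j, 1 - K i ≤ j → j ≤ 0 → (W i j : Sym2 V) = s(v i (-j + 1), v i (-j)) := by
    intro i j h1 h2
    simp only [W]
    rw [dif_pos ⟨h1, h2⟩]
  have hglue : ∀ i, W i 1 = W (i + 1) 0 := by
    intro i
    have := hK (i + 1)
    simp only [W]
    rw [dif_neg (by omega), dif_pos (by omega)]
  refine ⟨W, fun _ => le_rfl, fun i => by have := hK i; omega, hglue, ?_, ?_⟩
  · intro i j hj hj'
    obtain ⟨p, pi, pa, p0, p1⟩ := h.exists_path (f1 i)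
    have l1 := hlen i (i + 1) (f1 i)
    have k1 := hK i
    have k2 := hK (i + 1)
    have hon : OnPath n G (p (j - 1)) (p (j - 1 + 1)) (p (j - 1 + 2)) :=
      ⟨p, _, _, by omega, pi, pa, j - 1, by omega, by omega, rfl, rfl, rfl⟩
    refine hon.hLineGraph_adj hn ?_ ?_
    · rw [hW i j (by omega) (by omega), p0 _ (by omega), p0 _ (by omega)]
      congr 3 <;> ring
    · rcases lt_or_eq_of_le (show j ≤ 0 by omega) with h0 | rfl
      · rw [hW i (j + 1) (by omega) (by omega), p0 _ (by omega), p0 _ (by omega)]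
        congr 3 <;> ring
      · rw [zero_add, hglue, hW _ 0 (by omega) le_rfl, p1 _ (by omega), p1 _ (by omega),
          Sym2.eq_swap]
        rfl
  · intro i j i' j' _ _ _ _ he
    have he' := congrArg Subtype.val he
    rw [hW i j (by omega) (by omega), hW i' j' (by omega) (by omega), Sym2.eq_iff] at he'
    rcases he' with ⟨e1, -⟩ | ⟨e1, e2⟩
    · have := h.inj _ _ _ _ (by omega) (by omega) (by omega) (by omega) e1
      omega
    · have := h.inj _ _ _ _ (by omega) (by omega) (by omega) (by omega) e1
      have := h.inj _ _ _ _ (by omega) (by omega) (by omega) (by omega) e2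
      omega

/-- The vertex at distance `j` from the center on the `i`-th leg of `CL(x, y, z)`. -/
def spiderLeg (x y z : ℕ) : Fin 3 → ℤ → Option (Fin x ⊕ Fin y ⊕ Fin z)
  | 0, j => if h : 1 ≤ j ∧ j ≤ x then some (.inl ⟨(j - 1).toNat, by omega⟩) else none
  | 1, j => if h : 1 ≤ j ∧ j ≤ y then some (.inr (.inl ⟨(j - 1).toNat, by omega⟩)) else none
  | 2, j => if h : 1 ≤ j ∧ j ≤ z then some (.inr (.inr ⟨(j - 1).toNat, by omega⟩)) else none

theorem threeLegs_spiderLeg (x y z : ℕ) :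
    ThreeLegs (spiderCL x y z) ![(x : ℤ), y, z] (spiderLeg x y z) := by
  have hcenter : ∀ i, spiderLeg x y z i 0 = none := by
    intro i
    fin_cases i <;> simp [spiderLeg]
  refine ⟨fun i j => by rw [hcenter, hcenter], ?_, ?_⟩
  · intro i j h0 h1
    have hrel : spiderRel x y z (spiderLeg x y z i j) (spiderLeg x y z i (j + 1)) := by
      rcases eq_or_lt_of_le h0 with rfl | h0
      · rw [hcenter]
        fin_cases i <;> simp at h1 <;>
          simp [spiderLeg, spiderRel, Nat.one_le_iff_ne_zero, h1.ne']
      · have e0 : 1 ≤ j := h0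
        have e1 : 1 ≤ j + 1 := by omega
        fin_cases i <;> simp at h1 <;>
          simp [spiderLeg, spiderRel, e0, e1, h1.le, show j + 1 ≤ _ from h1] <;> omega
    rw [spiderCL, SimpleGraph.fromRel_adj]
    refine ⟨?_, Or.inl hrel⟩
    intro he
    rw [← he] at hrel
    revert hrel
    generalize spiderLeg x y z i j = q
    rcases q with _ | q | q | q <;> simp [spiderRel]
  · intro i j i' j' h0 h1 h0' h1'
    fin_cases i <;> fin_cases i' <;> simp at h1 h1' <;> simp only [spiderLeg] <;>
      split_ifs <;> simp <;> omega

/-! ### Assembling the phases -/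

theorem theorem4 (n k : ℕ) (hnk : n ≤ 2 * k) (hkn : k + 1 < n) :
    DivergesByOrder (SimpleGraph.pathGraph n) (spiderCL k k (n - k - 1)) := by
  obtain ⟨m, hm⟩ : ∃ m, m = n - k - 1 := ⟨_, rfl⟩
  rw [← hm]
  have hlegs := threeLegs_spiderLeg k k m
  have hlen : ∀ i j, i ≠ j →
      (n : ℤ) ≤ (![(k : ℤ), k, m] : Fin 3 → ℤ) i + (![(k : ℤ), k, m] : Fin 3 → ℤ) j + 1 := by
    intro i j hij
    fin_cases i <;> fin_cases j <;> simp at hij ⊢ <;> omega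
  have hK : ∀ i, (m : ℤ) ≤ (![(k : ℤ), k, m] : Fin 3 → ℤ) i := by
    intro i
    fin_cases i <;> simp <;> omega
  have key : ∀ d : ℕ, d + 1 ≤ m → ∃ w,
      TailedCycle (HLineIter (SimpleGraph.pathGraph n) (spiderCL k k m) (d + 1)).2
        (fun i => i + 1) (fun _ => ((d + 1 : ℕ) : ℤ))
        (fun i => (![(k : ℤ), k, m] : Fin 3 → ℤ) i - ((d + 1 : ℕ) : ℤ)) w := by
    intro d
    induction d with
    | zero =>
      intro hd
      exact hlegs.hLineGraph (by omega) (fun i => by have := hK i; omega) hlen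
    | succ d ih =>
      intro hd
      obtain ⟨w, hw⟩ := ih (by omega)
      exact hw.hLineGraph_three (by omega) (fun i => by have := hK i; omega) hlen
  obtain ⟨d, rfl⟩ : ∃ d, m = d + 1 := ⟨m - 1, by omega⟩
  obtain ⟨w, hw⟩ := key d le_rfl
  -- Here `n ≤ 2 * k` is what makes both long tails nonempty when the short one is used up.
  obtain ⟨s, hs⟩ : ∃ s, k = d + 1 + (s + 1) := ⟨k - d - 2, by omega⟩
  have ht : (k : ℤ) - ((d + 1 : ℕ) : ℤ) = s + 1 := by omega
  obtain ⟨w', hw'⟩ := hw.forget_tail (t := (s : ℤ) + 1) ht ht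
  exact TailedCycle.divergesByOrder_two (by omega) s _ _ _ hw' (by simp) (by simp; omega)
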